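/- Let $V$ be a compact metric space with metric $d_V$ and let $g:V\to V$ be a continuous open surjection. Suppose that $(V,g)$ satisfies Wieler's axioms with constants $\beta>0$, $K\in\mathbb N_{\ge 1}$ and $\gamma\in(0,1)$, that is: 1. if $v,w\in V$ and $d_V(v,w)<\beta$, then $d_V(g^K(v),g^K(w))\le\gamma^K d_V(g^{2K}(v),g^{2K}(w))$; 2. for all $v\in V$ and $\varepsilon\in(0,\beta]$, $g^K(B(g^K(v),\varepsilon))\subseteq g^{2K}(B(v,\gamma\varepsilon))$, where $B$ denotes open balls. Let $X=\{(x_i)_{i\ge 0}\in V^{\mathbb N}: x_i=g(x_{i+1})\text{ for all } i\}$ with the topology induced by the product topology, and let $\varphi:X\to X$, $\varphi(x_0,x_1,\dots)=(g(x_0),x_0,x_1,\dots)$, be the shift homeomorphism. Suppose that $(X,\varphi)$ is irreducible: for all non-empty open $U,W\subseteq X$ there is $N\in\mathbb N$ with $\varphi^N(U)\cap W\ne\varnothing$. Let $P\subseteq X$ be a non-empty finite $\varphi$-invariant set of $\varphi$-periodic points. A Smale space structure on $(X,\varphi)$ consists of a metric $d_X$ inducing the topology of $X$, constants $\varepsilon_X>0$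 and $0<\lambda<1$, and a continuous map $[\cdot,\cdot]:\{(x,y)\in X\times X: d_X(x,y)\le\varepsilon_X\}\to X$ such that $[x,x]=x$; $[x,[y,z]]=[x,z]$, $[[x,y],z]=[x,z]$ and $\varphi[x,y]=[\varphi(x),\varphi(y)]$ whenever both sides are defined; $d_X(\varphi(x),\varphi(y))\le\lambda d_X(x,y)$ whenever $[x,y]=y$; and $d_X(\varphi^{-1}(x),\varphi^{-1}(y))\le\lambda d_X(x,y)$ whenever $[x,y]=x$. Given such a structure, put $$X^u(P)=\{x\in X:\ \exists\, p\in P,\ \lim_{n\to\infty}d_X(\varphi^{-n}(x),\varphi^{-n}(p))=0\},$$ with the topology generated by the local unstable sets $X^u(x,\varepsilon)=\{y\in X: d_X(x,y)<\varepsilon,\ [x,y]=x\}$, where $x\in X^u(P)$ and $0<\varepsilon\le\varepsilon_X$. Then $(X,\varphi)$ has a Smale space structure whose metric is Wieler's metric $$d_X(x,y)=\sum_{k=0}^{K}\gamma^{-k}\sup_{i\ge 0}\gamma^i d_V(x_{i+k},y_{i+k}),$$ and, for every Smale space structure on $(X,\varphi)$, the projection $\pi_0:X^u(P)\to V$, $x=(x_0,x_1,\dots)\mapsto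 x_0$, is a surjective covering map. In particular, $X^u(P)$ is a locally trivial bundle over $V$ with discrete fibres. -/

import Mathlib

open Set Filter Topology

/-- Wieler's axioms for a self-map `g` of a metric space `V`, with constants `β`, `γ`, `K`.
Balls are open balls. -/
structure WielerAxioms {V : Type*} [MetricSpace V] (g : V → V) (β γ : ℝ) (K : ℕ) : Prop where
  beta_pos : 0 < β
  K_pos : 0 < K
  gamma_pos : 0 < γ
  gamma_lt_one : γ < 1
  axiom1 : ∀ v w : V, dist v w < β →
    dist (g^[K] v) (g^[K] w) ≤ γ ^ K * dist (g^[2 * K] v) (g^[2 * K] w)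
  axiom2 : ∀ v : V, ∀ ε : ℝ, 0 < ε → ε ≤ β →
    g^[K] '' Metric.ball (g^[K] v) ε ⊆ g^[2 * K] '' Metric.ball v (γ * ε)

/-- The solenoid `X_V`: the inverse limit `V ← V ← V ← ⋯` along `g`. -/
def Solenoid {V : Type*} [TopologicalSpace V] (g : C(V, V)) : Type _ :=
  {x : ℕ → V // ∀ i, x i = g (x (i + 1))}

namespace Solenoid

variable {V : Type*}

/-- The topology of the inverse limit (subspace of the product). -/
instance [TopologicalSpace V] (g : C(V, V)) : TopologicalSpace (Solenoid g) :=
  instTopologicalSpaceSubtype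

instance [TopologicalSpace V] [T2Space V] [CompactSpace V] (g : C(V, V)) :
    CompactSpace (Solenoid g) := by
  have hc : IsClosed {x : ℕ → V | ∀ i, x i = g (x (i + 1))} := by
    simp only [Set.ofPred_forall]
    exact isClosed_iInter fun i =>
      isClosed_eq (continuous_apply i) (g.continuous.comp (continuous_apply (i + 1)))
  exact isCompact_iff_compactSpace.mp hc.isCompact

/-- The projection `π_k (v₀, v₁, …) = v_k`. -/
def proj [TopologicalSpace V] {g : C(V, V)} (k : ℕ) (x : Solenoid g) : V := x.1 k

/-- The shift homeomorphism `φ_g (v₀, v₁, …) = (g v₀, g v₁, …) = (g v₀, v₀, v₁, …)`; its inverse is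
`(v₀, v₁, …) ↦ (v₁, v₂, …)`. -/
def shift [TopologicalSpace V] (g : C(V, V)) : Solenoid g ≃ₜ Solenoid g where
  toFun x := ⟨fun i => g (x.1 i), fun i => congrArg g (x.2 i)⟩
  invFun x := ⟨fun i => x.1 (i + 1), fun i => x.2 (i + 1)⟩
  left_inv x := Subtype.ext (funext fun i => (x.2 i).symm)
  right_inv x := Subtype.ext (funext fun i => (x.2 i).symm)
  continuous_toFun := by
    refine Continuous.subtype_mk (continuous_pi fun i => ?_) _
    exact g.continuous.comp ((continuous_apply i).comp continuous_subtype_val)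
  continuous_invFun := by
    refine Continuous.subtype_mk (continuous_pi fun i => ?_) _
    exact (continuous_apply (i + 1)).comp continuous_subtype_val

/-- Wieler's metric `∑_{k=0}^K γ^{-k} sup_i γ^i d_V(x_{i+k}, y_{i+k})` on the solenoid. For compact
`V` and `0 < γ < 1` the supremum is over a bounded family. -/
noncomputable def wielerDist [MetricSpace V] {g : C(V, V)} (γ : ℝ) (K : ℕ)
    (x y : Solenoid g) : ℝ :=
  ∑ k ∈ Finset.range (K + 1), (γ ^ k)⁻¹ * ⨆ i : ℕ, γ ^ i * dist (x.1 (i + k)) (y.1 (i + k))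

end Solenoid

/-- Irreducibility of a dynamical system. -/
def IsIrreducibleSystem {X : Type*} [TopologicalSpace X] (φ : X → X) : Prop :=
  ∀ U W : Set X, IsOpen U → IsOpen W → U.Nonempty → W.Nonempty →
    ∃ N : ℕ, (φ^[N] '' U ∩ W).Nonempty

/-- A Smale space structure (Ruelle's axioms) on a compact metrizable space `X` with a homeomorphism
`φ`: a metric inducing the topology, constants `0 < lam < 1` and `ε_X > 0`, and a bracket. The
bracket is a total function, but only its values on pairs at distance at most `ε_X` are used. -/
structure SmaleStructure {X : Type*} [TopologicalSpace X] [CompactSpace X] (φ : X ≃ₜ X) where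
  /-- the metric -/
  metric : MetricSpace X
  metric_topology : metric.toUniformSpace.toTopologicalSpace = (inferInstance : TopologicalSpace X)
  /-- the contraction constant -/
  lam : ℝ
  /-- the radius `ε_X` within which the bracket is defined -/
  epsX : ℝ
  /-- the bracket -/
  bracket : X → X → X
  lam_pos : 0 < lam
  lam_lt_one : lam < 1
  epsX_pos : 0 < epsX
  continuousOn_bracket :
    ContinuousOn (fun p : X × X => bracket p.1 p.2) {p | metric.dist p.1 p.2 ≤ epsX}
  B1 : ∀ x, bracket x x = x
  B2 : ∀ x y z, metric.dist y z ≤ epsX → metric.dist x (bracket y z) ≤ epsX →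
    metric.dist x z ≤ epsX → bracket x (bracket y z) = bracket x z
  B3 : ∀ x y z, metric.dist x y ≤ epsX → metric.dist (bracket x y) z ≤ epsX →
    metric.dist x z ≤ epsX → bracket (bracket x y) z = bracket x z
  B4 : ∀ x y, metric.dist x y ≤ epsX → metric.dist (φ x) (φ y) ≤ epsX →
    φ (bracket x y) = bracket (φ x) (φ y)
  C1 : ∀ x y, metric.dist x y ≤ epsX → bracket x y = y →
    metric.dist (φ x) (φ y) ≤ lam * metric.dist x y
  C2 : ∀ x y, metric.dist x y ≤ epsX → bracket x y = x →
    metric.dist (φ.symm x) (φ.symm y) ≤ lam * metric.dist x y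

namespace SmaleStructure

variable {X : Type*} [TopologicalSpace X] [CompactSpace X] {φ : X ≃ₜ X}

/-- The distance `d_X`. -/
def d (S : SmaleStructure φ) (x y : X) : ℝ := S.metric.dist x y

/-- The local unstable set `X^u(x, ε) = {y : d_X(x,y) < ε, [x,y] = x}`, for `0 < ε ≤ ε_X`. -/
def localUnstable (S : SmaleStructure φ) (x : X) (ε : ℝ) : Set X :=
  {y | S.d x y < ε ∧ S.bracket x y = x}

/-- Unstable equivalence `x ∼_u y`: `d_X(φ⁻ⁿ x, φ⁻ⁿ y) → 0`. -/
def UnstableEquiv (S : SmaleStructure φ) (x y : X) : Prop :=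
  Tendsto (fun n : ℕ => S.d (φ.symm^[n] x) (φ.symm^[n] y)) atTop (𝓝 0)

/-- The global unstable set `X^u(P) = ⋃_{p ∈ P} X^u(p)`, as a type of its own since its topology is
not the subspace topology. -/
def UnstableSet (S : SmaleStructure φ) (P : Set X) : Type _ :=
  {x : X // ∃ p ∈ P, S.UnstableEquiv x p}

/-- The topology on `X^u(P)` generated by the local unstable sets `X^u(x, ε)` with `x ∈ X^u(P)` and
`0 < ε ≤ ε_X`. -/
instance (S : SmaleStructure φ) (P : Set X) : TopologicalSpace (S.UnstableSet P) :=
  TopologicalSpace.generateFrom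
    {U | ∃ x : S.UnstableSet P, ∃ ε : ℝ, 0 < ε ∧ ε ≤ S.epsX ∧
      U = {y : S.UnstableSet P | y.1 ∈ S.localUnstable x.1 ε}}

end SmaleStructure

/-! ### Compactness preliminaries -/

/-! The map `g` is locally expanding, so backward orbits can be lifted uniquely. Since `g^K` is onto
and uniformly open, nearby points have preimages under `g^K` at distance less than `β`, and axiom 1
becomes `d(v, w) ≤ γ^K d(g^K v, g^K w)` for nearby `v, w`. The gauge `ρ(v, w) = ∑_{j<K} γ^j d(g^j v,
g^j w)` then expands by `γ⁻¹` in a single step (`WielerAxioms.exists_gauge`).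

Openness of `g` together with this expansion shows that every `w` with `ρ(w, y₀) ≤ s` is the zeroth
coordinate of exactly one point of `X` whose coordinates all stay `s`-close to those of `y`
(`IsAdaptedGauge.exists_lift`, `IsAdaptedGauge.solenoid_eq_of_near`). This lift of `w` along `y`
depends continuously on the pair. Taking `w = x₀` defines the bracket `[x, y]`, and the same lifts
are the local sections of `π₀`.

For an arbitrary Smale structure, the topology of `X^u(P)` is that of uniform closeness of backward
orbits. By compactness of `X` this is uniform closeness of all coordinates in `ρ`, whatever the
structure. Lifts therefore stay in `X^u(P)`, vary continuously and trivialise `π₀` over `ρ`-balls of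
radius `s`. As the radius is uniform, the image of `π₀` is open and closed; it is also
`g`-invariant, so irreducibility makes it all of `V`. -/

theorem exists_pos_forall_mem_le {X : Type*} [TopologicalSpace X] [CompactSpace X] {f : X → ℝ}
    (hf : Continuous f) {C : Set X} (hC : IsClosed C) (hpos : ∀ x ∈ C, 0 < f x) :
    ∃ η > 0, ∀ x ∈ C, η ≤ f x := by
  rcases C.eq_empty_or_nonempty with rfl | hne
  · exact ⟨1, one_pos, by simp⟩
  · obtain ⟨x, hx, hmin⟩ := hC.isCompact.exists_isMinOn hne hf.continuousOn
    exact ⟨f x, hpos x hx, fun y hy => hmin hy⟩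

/-- Two continuous functions on `X × X` that vanish exactly on the diagonal are uniformly
comparable. -/
theorem exists_pos_forall_lt_imp_lt {X : Type*} [TopologicalSpace X] [CompactSpace X]
    {d₁ d₂ : X → X → ℝ} (h₁ : Continuous fun p : X × X => d₁ p.1 p.2)
    (h₂ : Continuous fun p : X × X => d₂ p.1 p.2) (hpos : ∀ x y, x ≠ y → 0 < d₁ x y)
    (hself : ∀ x, d₂ x x = 0) {ε : ℝ} (hε : 0 < ε) :
    ∃ η > 0, ∀ x y, d₁ x y < η → d₂ x y < ε := by
  obtain ⟨η, hη, h⟩ := exists_pos_forall_mem_le h₁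
    (isClosed_le continuous_const h₂ : IsClosed {p : X × X | ε ≤ d₂ p.1 p.2}) (by
      rintro ⟨x, y⟩ hxy
      refine hpos x y ?_
      rintro rfl
      have : ε ≤ d₂ x x := hxy
      rw [hself] at this
      linarith)
  refine ⟨η, hη, fun x y hxy => ?_⟩
  by_contra! hc
  exact absurd (h (x, y) hc) (not_le.2 hxy)

/-- An open continuous self-map of a compact metric space is uniformly open. -/
theorem exists_pos_uniformly_open {V : Type*} [MetricSpace V] [CompactSpace V] {f : V → V}
    (hf : Continuous f) (ho : IsOpenMap f) {r : ℝ} (hr : 0 < r) :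
    ∃ s > 0, ∀ v w, dist (f v) w < s → ∃ u, f u = w ∧ dist u v < r := by
  have hloc : ∀ v : V, ∃ s > 0, Metric.ball (f v) s ⊆ f '' Metric.ball v (r / 2) := fun v =>
    Metric.mem_nhds_iff.1 (ho.image_mem_nhds (Metric.ball_mem_nhds v (half_pos hr)))
  choose s hs hsub using hloc
  obtain ⟨t, ht⟩ := CompactSpace.elim_nhds_subcover
    (fun v => Metric.ball v (r / 2) ∩ f ⁻¹' Metric.ball (f v) (s v / 2)) (fun v =>
      Filter.inter_mem (Metric.ball_mem_nhds v (half_pos hr))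
        (hf.continuousAt.preimage_mem_nhds (Metric.ball_mem_nhds _ (half_pos (hs v)))))
  have hmin : ∃ m > 0, ∀ v ∈ t, m ≤ s v / 2 := by
    rcases t.eq_empty_or_nonempty with rfl | hne
    · exact ⟨1, one_pos, by simp⟩
    · obtain ⟨v, hv, h⟩ := t.exists_min_image (fun v => s v / 2) hne
      exact ⟨s v / 2, half_pos (hs v), h⟩
  obtain ⟨m, hm, hmt⟩ := hmin
  refine ⟨m, hm, fun v w hvw => ?_⟩
  have hv : v ∈ ⋃ x ∈ t, Metric.ball x (r / 2) ∩ f ⁻¹' Metric.ball (f x) (s x / 2) := by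
    rw [ht]; trivial
  simp only [mem_iUnion, mem_inter_iff, Metric.mem_ball, mem_preimage] at hv
  obtain ⟨x, hxt, hvx, hfvx⟩ := hv
  obtain ⟨u, hu, rfl⟩ := hsub x (show w ∈ Metric.ball (f x) (s x) by
    rw [Metric.mem_ball]
    have := hmt x hxt
    have := dist_triangle w (f v) (f x)
    rw [dist_comm w (f v)] at this
    linarith)
  refine ⟨u, rfl, ?_⟩
  have := dist_triangle u x v
  rw [dist_comm x v] at this
  rw [Metric.mem_ball] at hu
  linarith

/-! ### An adapted gauge for which the map is expanding -/

/-- A distance function `ρ` dominating the metric for which the open map `g` is locally expanding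
by `γ⁻¹` in a single step, with local sections of a uniform size `s`. -/
structure IsAdaptedGauge {V : Type*} [MetricSpace V] (g : V → V) (γ δ s : ℝ) (K : ℕ)
    (ρ : V → V → ℝ) : Prop where
  gamma_pos : 0 < γ
  gamma_lt_one : γ < 1
  s_pos : 0 < s
  s_le : 4 * s ≤ δ
  dist_le : ∀ v w, dist v w ≤ ρ v w
  self : ∀ v, ρ v v = 0
  comm : ∀ v w, ρ v w = ρ w v
  triangle : ∀ u v w, ρ u w ≤ ρ u v + ρ v w
  cont : Continuous fun p : V × V => ρ p.1 p.2
  expand : ∀ v w, ρ v w ≤ δ → ρ v w ≤ γ * ρ (g v) (g w)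
  expand_dist : ∀ v w, ρ v w ≤ δ → dist v w ≤ γ ^ K * dist (g^[K] v) (g^[K] w)
  lift : ∀ v w, ρ (g v) w ≤ s → ∃ u, g u = w ∧ ρ u v ≤ δ

/-- Summing the metric along the first `K` iterates spreads a `K`-step expansion evenly over single
steps. -/
theorem WielerAxioms.exists_gauge {V : Type*} [MetricSpace V] [CompactSpace V] {g : V → V}
    (hg : Continuous g) (hsurj : Function.Surjective g) (hopen : IsOpenMap g)
    {β γ : ℝ} {K : ℕ} (hW : WielerAxioms g β γ K) :
    ∃ (δ s : ℝ) (ρ : V → V → ℝ), IsAdaptedGauge g γ δ s K ρ := by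
  have hγ := hW.gamma_pos
  have hiter : ∀ n : ℕ, IsOpenMap g^[n] := fun n => by
    induction n with
    | zero => exact IsOpenMap.id
    | succ n ih => exact ih.comp hopen
  obtain ⟨δ₀, hδ₀, hK⟩ := exists_pos_uniformly_open (hg.iterate K) (hiter K) hW.beta_pos
  have hexp : ∀ v w, dist v w < δ₀ → dist v w ≤ γ ^ K * dist (g^[K] v) (g^[K] w) := by
    intro v w hvw
    obtain ⟨v', rfl⟩ := hsurj.iterate K v
    obtain ⟨w', rfl, hw'⟩ := hK v' w hvw
    have := hW.axiom1 v' w' (by rwa [dist_comm])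
    rwa [two_mul, Function.iterate_add_apply, Function.iterate_add_apply] at this
  set ρ : V → V → ℝ := fun v w => ∑ j ∈ Finset.range K, γ ^ j * dist (g^[j] v) (g^[j] w) with hρ
  have hcont : Continuous fun p : V × V => ρ p.1 p.2 := by
    refine continuous_finsetSum _ fun j _ => continuous_const.mul ?_
    exact ((hg.iterate j).comp continuous_fst).dist ((hg.iterate j).comp continuous_snd)
  have hdist : ∀ v w, dist v w ≤ ρ v w := fun v w => by
    have := Finset.single_le_sum (f := fun j => γ ^ j * dist (g^[j] v) (g^[j] w))
      (fun j _ => by positivity) (Finset.mem_range.2 hW.K_pos)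
    simpa using this
  have hself : ∀ v, ρ v v = 0 := fun v => by simp [hρ]
  obtain ⟨r, hr, hrρ⟩ := exists_pos_forall_lt_imp_lt (d₁ := fun v w : V => dist v w) (d₂ := ρ)
    continuous_dist hcont (fun x y h => dist_pos.2 h) hself (half_pos hδ₀)
  obtain ⟨s₀, hs₀, hlift⟩ := exists_pos_uniformly_open hg hopen hr
  -- Halving `δ₀` and `s₀` turns non-strict bounds into strict ones; `δ₀ / 8` gives `4 * s ≤ δ`, the
  -- room needed to compare two lifts along orbits `2 * s` apart.
  refine ⟨δ₀ / 2, min (s₀ / 2) (δ₀ / 8), ρ, hγ, hW.gamma_lt_one, by positivity, ?_, hdist, hself,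
    ?_, ?_, hcont, ?_, ?_, ?_⟩
  · linarith [min_le_right (s₀ / 2) (δ₀ / 8)]
  · intro v w
    simp only [hρ, dist_comm]
  · intro u v w
    simp only [hρ, ← Finset.sum_add_distrib, ← mul_add]
    gcongr
    exact dist_triangle _ _ _
  · intro v w hvw
    have h0 : dist v w < δ₀ := by linarith [hdist v w]
    have h1 := hexp v w h0
    -- Both sides are the sum of `γ^j d(g^j v, g^j w)` over `j ≤ K`, split off at the first or at
    -- the last term.
    have h2 : γ * ρ (g v) (g w) + dist v w = ρ v w + γ ^ K * dist (g^[K] v) (g^[K] w) := by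
      simp only [hρ]
      rw [← Finset.sum_range_succ (fun j => γ ^ j * dist (g^[j] v) (g^[j] w)),
        Finset.sum_range_succ', Finset.mul_sum]
      simp [pow_succ', mul_assoc]
    linarith
  · intro v w hvw
    exact hexp v w (by linarith [hdist v w])
  · intro v w hvw
    obtain ⟨u, hu, huv⟩ := hlift v w (by
      linarith [hdist (g v) w, min_le_left (s₀ / 2) (δ₀ / 8)])
    exact ⟨u, hu, (hrρ u v huv).le⟩

/-- Closed graph theorem for maps into a compact space. -/
theorem continuous_of_isClosed_graph {X Y : Type*} [TopologicalSpace X] [TopologicalSpace Y]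
    [CompactSpace Y] {f : X → Y} (hf : IsClosed {q : X × Y | q.2 = f q.1}) : Continuous f := by
  refine continuous_iff_isClosed.2 fun F hF => ?_
  have : f ⁻¹' F = Prod.fst '' ({q : X × Y | q.2 = f q.1} ∩ Prod.snd ⁻¹' F) := by
    ext x
    constructor
    · exact fun hx => ⟨(x, f x), ⟨rfl, hx⟩, rfl⟩
    · rintro ⟨q, ⟨hq, hy⟩, rfl⟩
      rw [mem_preimage, ← show q.2 = f q.1 from hq]
      exact hy
  rw [this]
  exact isClosedMap_fst_of_compactSpace _ (hf.inter (hF.preimage continuous_snd))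

/-! ### Backward orbits: unique lifting in the solenoid -/

namespace Solenoid

variable {V : Type*} [MetricSpace V] {g : C(V, V)} {γ δ s : ℝ} {K : ℕ} {ρ : V → V → ℝ}

theorem continuous_coord (i : ℕ) : Continuous fun x : Solenoid g => x.1 i :=
  (continuous_apply i).comp continuous_subtype_val

theorem iterate_coord (x : Solenoid g) (n i : ℕ) : g^[n] (x.1 (i + n)) = x.1 i := by
  induction n with
  | zero => rfl
  | succ n ih => rw [Function.iterate_succ_apply, ← add_assoc, ← x.2, ih]

theorem shift_symm_iterate_coord (x : Solenoid g) (n i : ℕ) :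
    ((shift g).symm^[n] x).1 i = x.1 (i + n) := by
  induction n generalizing i with
  | zero => rfl
  | succ n ih =>
    rw [Function.iterate_succ_apply']
    change ((shift g).symm^[n] x).1 (i + 1) = _
    rw [ih, add_assoc, add_comm 1 n]

end Solenoid

namespace IsAdaptedGauge

variable {V : Type*} [MetricSpace V] {g : C(V, V)} {γ δ s : ℝ} {K : ℕ} {ρ : V → V → ℝ}

theorem nonneg (h : IsAdaptedGauge g γ δ s K ρ) (v w : V) : 0 ≤ ρ v w :=
  dist_nonneg.trans (h.dist_le v w)

theorem eq_of_nonpos (h : IsAdaptedGauge g γ δ s K ρ) {v w : V} (hvw : ρ v w ≤ 0) : v = w :=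
  dist_le_zero.1 ((h.dist_le v w).trans hvw)

theorem isOpen_gauge_ball (h : IsAdaptedGauge g γ δ s K ρ) (v : V) (r : ℝ) :
    IsOpen {w | ρ w v < r} :=
  isOpen_lt (h.cont.comp (continuous_id.prodMk continuous_const)) continuous_const

/-- Points of the solenoid that stay `δ`-close along the backward orbit approach geometrically. -/
theorem coord_le (h : IsAdaptedGauge g γ δ s K ρ) {x y : Solenoid g}
    (hxy : ∀ i, ρ (x.1 i) (y.1 i) ≤ δ) (i : ℕ) :
    ρ (x.1 i) (y.1 i) ≤ γ ^ i * ρ (x.1 0) (y.1 0) := by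
  induction i with
  | zero => simp
  | succ i ih =>
    have h1 := h.expand _ _ (hxy (i + 1))
    rw [← x.2, ← y.2] at h1
    have h2 := mul_le_mul_of_nonneg_left ih h.gamma_pos.le
    rw [pow_succ']
    linarith

theorem coord_le_zero (h : IsAdaptedGauge g γ δ s K ρ) {x y : Solenoid g}
    (hxy : ∀ i, ρ (x.1 i) (y.1 i) ≤ δ) (i : ℕ) :
    ρ (x.1 i) (y.1 i) ≤ ρ (x.1 0) (y.1 0) :=
  (h.coord_le hxy i).trans (mul_le_of_le_one_left (h.nonneg _ _)
    (pow_le_one₀ h.gamma_pos.le h.gamma_lt_one.le))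

theorem solenoid_eq (h : IsAdaptedGauge g γ δ s K ρ) {x y : Solenoid g}
    (hxy : ∀ i, ρ (x.1 i) (y.1 i) ≤ δ) (h0 : x.1 0 = y.1 0) : x = y := by
  refine Subtype.ext (funext fun i => h.eq_of_nonpos ?_)
  have := h.coord_le_zero hxy i
  rwa [h0, h.self] at this

/-- Two lifts of the same point along nearby backward orbits agree. -/
theorem solenoid_eq_of_near (h : IsAdaptedGauge g γ δ s K ρ) {x y z w : Solenoid g}
    (hx : ∀ i, ρ (x.1 i) (z.1 i) ≤ s) (hy : ∀ i, ρ (y.1 i) (w.1 i) ≤ s)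
    (hzw : ∀ i, ρ (z.1 i) (w.1 i) ≤ 2 * s) (h0 : x.1 0 = y.1 0) : x = y := by
  refine h.solenoid_eq (fun i => ?_) h0
  have h1 := h.triangle (x.1 i) (z.1 i) (y.1 i)
  have h2 := h.triangle (z.1 i) (w.1 i) (y.1 i)
  have h3 := hy i
  rw [h.comm] at h3
  linarith [hx i, hzw i, h.s_le]

/-- Every point near `y₀` lifts to a point of the solenoid that follows the backward orbit `y`. -/
theorem exists_lift (h : IsAdaptedGauge g γ δ s K ρ) (y : Solenoid g) {w : V}
    (hw : ρ w (y.1 0) ≤ s) :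
    ∃ z : Solenoid g, z.1 0 = w ∧ ∀ i, ρ (z.1 i) (y.1 i) ≤ s := by
  have hstep : ∀ i w, ρ w (y.1 i) ≤ s → ∃ u, g u = w ∧ ρ u (y.1 (i + 1)) ≤ s := by
    intro i w hw
    rw [y.2 i, h.comm] at hw
    obtain ⟨u, rfl, hu⟩ := h.lift _ _ hw
    refine ⟨u, rfl, ?_⟩
    -- The lift is known only to be `δ`-close; expansion improves this to `γ * s ≤ s`, so the
    -- induction can continue.
    have h1 := h.expand _ _ hu
    rw [h.comm] at hw
    have h2 := mul_le_of_le_one_left (h.nonneg (g u) (g (y.1 (i + 1)))) h.gamma_lt_one.le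
    linarith
  choose! f hf hfs using hstep
  let z : ℕ → V := fun n => Nat.rec w f n
  have hz : ∀ i, ρ (z i) (y.1 i) ≤ s := fun i => by
    induction i with
    | zero => exact hw
    | succ i ih => exact hfs i (z i) ih
  exact ⟨⟨z, fun i => (hf i (z i) (hz i)).symm⟩, rfl, hz⟩

end IsAdaptedGauge

namespace Solenoid

variable {V : Type*} [MetricSpace V] {g : C(V, V)} {γ δ s : ℝ} {K : ℕ} {ρ : V → V → ℝ}

open Classical in
/-- The lift of the point `w` along the backward orbit `y`. -/
noncomputable def liftAlong (ρ : V → V → ℝ) (s : ℝ) (w : V) (y : Solenoid g) : Solenoid g :=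
  -- The default `y` trivially follows `y`, so `liftAlong_near` holds for every `w` and
  -- `unstableLift` needs no side condition.
  if h : ∃ z : Solenoid g, z.1 0 = w ∧ ∀ i, ρ (z.1 i) (y.1 i) ≤ s then h.choose else y

end Solenoid

namespace IsAdaptedGauge

open Solenoid

variable {V : Type*} [MetricSpace V] {g : C(V, V)} {γ δ s : ℝ} {K : ℕ} {ρ : V → V → ℝ}

theorem liftAlong_spec (h : IsAdaptedGauge g γ δ s K ρ) {y : Solenoid g} {w : V}
    (hw : ρ w (y.1 0) ≤ s) :
    (liftAlong ρ s w y).1 0 = w ∧ ∀ i, ρ ((liftAlong ρ s w y).1 i) (y.1 i) ≤ s := by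
  have := h.exists_lift y hw
  rw [liftAlong, dif_pos this]
  exact this.choose_spec

theorem liftAlong_near (h : IsAdaptedGauge g γ δ s K ρ) (w : V) (y : Solenoid g) (i : ℕ) :
    ρ ((liftAlong ρ s w y).1 i) (y.1 i) ≤ s := by
  by_cases hz : ∃ z : Solenoid g, z.1 0 = w ∧ ∀ i, ρ (z.1 i) (y.1 i) ≤ s
  · rw [liftAlong, dif_pos hz]
    exact hz.choose_spec.2 i
  · rw [liftAlong, dif_neg hz, h.self]
    exact h.s_pos.le

theorem eq_liftAlong (h : IsAdaptedGauge g γ δ s K ρ) {z y : Solenoid g}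
    (hz : ∀ i, ρ (z.1 i) (y.1 i) ≤ s) : z = liftAlong ρ s (z.1 0) y := by
  obtain ⟨h0, h1⟩ := h.liftAlong_spec (hz 0)
  exact h.solenoid_eq_of_near hz h1 (fun i => by rw [h.self]; linarith [h.s_pos]) h0.symm

theorem liftAlong_eq_liftAlong (h : IsAdaptedGauge g γ δ s K ρ) {y y' : Solenoid g} {w : V}
    (hw : ρ w (y.1 0) ≤ s) (hw' : ρ w (y'.1 0) ≤ s) (hy : ∀ i, ρ (y.1 i) (y'.1 i) ≤ 2 * s) :
    liftAlong ρ s w y = liftAlong ρ s w y' :=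
  h.solenoid_eq_of_near (h.liftAlong_spec hw).2 (h.liftAlong_spec hw').2 hy
    ((h.liftAlong_spec hw).1.trans (h.liftAlong_spec hw').1.symm)

/-- By uniqueness of lifts the graph is cut out by the closed conditions `z₀ = w` and `ρ(z_i, y_i) ≤
s`, and the target is compact. -/
theorem continuousOn_liftAlong [CompactSpace V] (h : IsAdaptedGauge g γ δ s K ρ) :
    ContinuousOn (fun p : V × Solenoid g => liftAlong ρ s p.1 p.2)
      {p | ρ p.1 (p.2.1 0) ≤ s} := by
  rw [continuousOn_iff_continuous_domRestrict]
  have hco : ∀ i, Continuous fun q : {p : V × Solenoid g | ρ p.1 (p.2.1 0) ≤ s} × Solenoid g =>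
      ρ (q.2.1 i) (q.1.1.2.1 i) := fun i =>
    h.cont.comp (((continuous_coord i).comp continuous_snd).prodMk ((continuous_coord i).comp
      (continuous_snd.comp (continuous_subtype_val.comp continuous_fst))))
  have hc0 : Continuous fun q : {p : V × Solenoid g | ρ p.1 (p.2.1 0) ≤ s} × Solenoid g =>
      q.1.1.1 := continuous_fst.comp (continuous_subtype_val.comp continuous_fst)
  refine continuous_of_isClosed_graph ?_
  have : {q : {p : V × Solenoid g | ρ p.1 (p.2.1 0) ≤ s} × Solenoid g |
      q.2 = liftAlong ρ s q.1.1.1 q.1.1.2} =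
      {q | q.2.1 0 = q.1.1.1} ∩ ⋂ i, {q | ρ (q.2.1 i) (q.1.1.2.1 i) ≤ s} := by
    ext q
    simp only [mem_inter_iff, mem_iInter, mem_ofPred_eq]
    constructor
    · intro hq
      rw [hq]
      exact h.liftAlong_spec q.1.2
    · rintro ⟨h0, h1⟩
      rw [← h0]
      exact h.eq_liftAlong h1
  exact this ▸ (isClosed_eq ((continuous_coord 0).comp continuous_snd) hc0).inter
    (isClosed_iInter fun i => isClosed_le (hco i) continuous_const)

end IsAdaptedGauge

/-! ### Wieler's metric: topology and contraction -/

theorem induced_eq_of_continuous_equiv {X Y : Type*} [t : TopologicalSpace X] [CompactSpace X]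
    [MetricSpace Y] (e : X ≃ Y) (h : ∀ x, Tendsto (fun y => dist (e x) (e y)) (𝓝 x) (𝓝 0)) :
    TopologicalSpace.induced e inferInstance = t := by
  have hc : Continuous e := continuous_iff_continuousAt.2 fun x =>
    tendsto_iff_dist_tendsto_zero.2 (by simpa only [dist_comm _ (e x)] using h x)
  exact hc.homeoOfEquivCompactToT2.isInducing.eq_induced.symm

/-- The identity is a continuous bijection from a compact space to a Hausdorff one, hence a
homeomorphism; no converse estimate is needed. -/
theorem MetricSpace.topology_eq_of_tendsto {X : Type*} [t : TopologicalSpace X] [CompactSpace X]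
    (m : MetricSpace X) (h : ∀ x, Tendsto (m.dist x) (𝓝 x) (𝓝 0)) :
    m.toUniformSpace.toTopologicalSpace = t :=
  (@induced_id X m.toUniformSpace.toTopologicalSpace).symm.trans (@induced_eq_of_continuous_equiv X X t _ m (Equiv.refl X) h)

theorem MetricSpace.continuous_dist_of_topology_eq {X : Type*} [t : TopologicalSpace X]
    (m : MetricSpace X) (h : m.toUniformSpace.toTopologicalSpace = t) :
    Continuous fun p : X × X => m.dist p.1 p.2 := by
  subst h
  exact continuous_dist

namespace Solenoid

section WeightedSup

variable {V : Type*} [MetricSpace V] {g : C(V, V)} {γ : ℝ} {K : ℕ}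

/-- The weighted supremum distance between the `k`-th backward shifts of two points. -/
noncomputable def weightedSup (γ : ℝ) (k : ℕ) (x y : Solenoid g) : ℝ :=
  ⨆ i : ℕ, γ ^ i * dist (x.1 (i + k)) (y.1 (i + k))

theorem wielerDist_eq (x y : Solenoid g) :
    wielerDist γ K x y = ∑ k ∈ Finset.range (K + 1), (γ ^ k)⁻¹ * weightedSup γ k x y := rfl

theorem weightedSup_self (k : ℕ) (x : Solenoid g) : weightedSup γ k x x = 0 := by
  simp [weightedSup]

theorem weightedSup_comm (k : ℕ) (x y : Solenoid g) :
    weightedSup γ k x y = weightedSup γ k y x := by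
  simp only [weightedSup, dist_comm]

theorem weightedSup_nonneg (h0 : 0 < γ) (k : ℕ) (x y : Solenoid g) : 0 ≤ weightedSup γ k x y :=
  Real.iSup_nonneg fun _ => by positivity

theorem weightedSup_le {k : ℕ} {x y : Solenoid g} {c : ℝ}
    (h : ∀ i, γ ^ i * dist (x.1 (i + k)) (y.1 (i + k)) ≤ c) : weightedSup γ k x y ≤ c :=
  ciSup_le h

theorem weightedSup_le_wielerDist (h0 : 0 < γ) (h1 : γ < 1) {k : ℕ} (hk : k ≤ K)
    (x y : Solenoid g) : weightedSup γ k x y ≤ wielerDist γ K x y := by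
  have hk' : k ∈ Finset.range (K + 1) := by simpa [Nat.lt_succ_iff] using hk
  have := Finset.single_le_sum (f := fun k => (γ ^ k)⁻¹ * weightedSup γ k x y)
    (fun j _ => mul_nonneg (by positivity) (weightedSup_nonneg h0 j x y)) hk'
  refine le_trans ?_ this
  exact le_mul_of_one_le_left (weightedSup_nonneg h0 k x y)
    ((one_le_inv₀ (by positivity)).2 (pow_le_one₀ h0.le h1.le))

variable [CompactSpace V]

theorem le_weightedSup (h0 : 0 < γ) (h1 : γ < 1) (k : ℕ) (x y : Solenoid g) (i : ℕ) :
    γ ^ i * dist (x.1 (i + k)) (y.1 (i + k)) ≤ weightedSup γ k x y := by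
  refine le_ciSup (f := fun i => γ ^ i * dist (x.1 (i + k)) (y.1 (i + k)))
    ⟨Metric.diam (univ : Set V), ?_⟩ i
  rintro _ ⟨j, rfl⟩
  refine (mul_le_of_le_one_left dist_nonneg (pow_le_one₀ h0.le h1.le)).trans ?_
  exact Metric.dist_le_diam_of_mem isCompact_univ.isBounded trivial trivial

theorem dist_le_weightedSup (h0 : 0 < γ) (h1 : γ < 1) (k : ℕ) (x y : Solenoid g) :
    dist (x.1 k) (y.1 k) ≤ weightedSup γ k x y := by
  simpa using le_weightedSup h0 h1 k x y 0

theorem weightedSup_succ_le (h0 : 0 < γ) (h1 : γ < 1) (k : ℕ) (x y : Solenoid g) :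
    γ * weightedSup γ (k + 1) x y ≤ weightedSup γ k x y := by
  rw [← le_div_iff₀' h0]
  refine weightedSup_le fun i => ?_
  rw [le_div_iff₀' h0, ← mul_assoc, ← pow_succ']
  have := le_weightedSup h0 h1 k x y (i + 1)
  rwa [add_assoc, add_comm 1 k] at this

theorem weightedSup_triangle (h0 : 0 < γ) (h1 : γ < 1) (k : ℕ) (x y z : Solenoid g) :
    weightedSup γ k x z ≤ weightedSup γ k x y + weightedSup γ k y z := by
  refine weightedSup_le fun i => ?_
  refine le_trans ?_ (add_le_add (le_weightedSup h0 h1 k x y i) (le_weightedSup h0 h1 k y z i))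
  rw [← mul_add]
  exact mul_le_mul_of_nonneg_left (dist_triangle _ _ _) (by positivity)

/-- The tail of the supremum is small because `V` has finite diameter, and the remaining finitely
many coordinates are continuous. -/
theorem tendsto_weightedSup (h0 : 0 < γ) (h1 : γ < 1) (k : ℕ) (x : Solenoid g) :
    Tendsto (weightedSup γ k x) (𝓝 x) (𝓝 0) := by
  refine tendsto_order.2 ⟨fun a ha => Eventually.of_forall fun y =>
    ha.trans_le (weightedSup_nonneg h0 k x y), fun a ha => ?_⟩
  have hdiam : 0 < Metric.diam (univ : Set V) + 1 := by
    linarith [Metric.diam_nonneg (s := (univ : Set V))]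
  obtain ⟨n, hn⟩ := exists_pow_lt_of_lt_one (div_pos (half_pos ha) hdiam) h1
  rw [lt_div_iff₀ hdiam] at hn
  have hev : ∀ᶠ y : Solenoid g in 𝓝 x, ∀ i ∈ Finset.range n,
      dist (x.1 (i + k)) (y.1 (i + k)) < a / 2 := by
    refine (Filter.eventually_all_finset _).2 fun i _ => ?_
    have hc : Continuous fun y : Solenoid g => dist (x.1 (i + k)) (y.1 (i + k)) :=
      continuous_const.dist (continuous_coord _)
    refine hc.continuousAt.eventually_lt continuousAt_const ?_
    simpa using ha
  filter_upwards [hev] with y hy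
  refine lt_of_le_of_lt (weightedSup_le fun i => ?_) (half_lt_self ha)
  rcases lt_or_ge i n with hi | hi
  · exact (mul_le_of_le_one_left dist_nonneg (pow_le_one₀ h0.le h1.le)).trans
      (hy i (Finset.mem_range.2 hi)).le
  · refine le_trans (mul_le_mul (pow_le_pow_of_le_one h0.le h1.le hi) ?_ dist_nonneg
      (by positivity)) hn.le
    refine (Metric.dist_le_diam_of_mem isCompact_univ.isBounded trivial trivial).trans ?_
    linarith

theorem dist_le_wielerDist (h0 : 0 < γ) (h1 : γ < 1) {k : ℕ} (hk : k ≤ K)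
    (x y : Solenoid g) : dist (x.1 k) (y.1 k) ≤ wielerDist γ K x y :=
  (dist_le_weightedSup h0 h1 k x y).trans (weightedSup_le_wielerDist h0 h1 hk x y)

theorem eq_of_wielerDist_eq_zero (h0 : 0 < γ) (h1 : γ < 1) {x y : Solenoid g}
    (h : wielerDist γ K x y = 0) : x = y := by
  refine Subtype.ext (funext fun i => dist_le_zero.1 ?_)
  have := le_weightedSup h0 h1 0 x y i
  have := weightedSup_le_wielerDist h0 h1 (Nat.zero_le K) x y
  exact nonpos_of_mul_nonpos_right (by simp only [add_zero] at *; linarith) (pow_pos h0 i)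

theorem tendsto_wielerDist (h0 : 0 < γ) (h1 : γ < 1) (K : ℕ) (x : Solenoid g) :
    Tendsto (wielerDist γ K x) (𝓝 x) (𝓝 0) := by
  have : Tendsto (fun y => ∑ k ∈ Finset.range (K + 1), (γ ^ k)⁻¹ * weightedSup γ k x y) (𝓝 x)
      (𝓝 (∑ k ∈ Finset.range (K + 1), (γ ^ k)⁻¹ * 0)) :=
    tendsto_finsetSum _ fun k _ => (tendsto_weightedSup h0 h1 k x).const_mul _
  rw [← show ∑ k ∈ Finset.range (K + 1), (γ ^ k)⁻¹ * (0 : ℝ) = 0 by simp]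
  exact this

/-- Wieler's metric on the solenoid. -/
@[reducible]
noncomputable def wielerMetric (g : C(V, V)) (h0 : 0 < γ) (h1 : γ < 1) (K : ℕ) :
    MetricSpace (Solenoid g) where
  dist := wielerDist γ K
  dist_self x := by simp [wielerDist_eq, weightedSup_self]
  dist_comm x y := by simp only [wielerDist_eq, weightedSup_comm]
  dist_triangle x y z := by
    simp only [wielerDist_eq, ← Finset.sum_add_distrib, ← mul_add]
    refine Finset.sum_le_sum fun k _ => mul_le_mul_of_nonneg_left ?_ (by positivity)
    exact weightedSup_triangle h0 h1 k x y z
  eq_of_dist_eq_zero := eq_of_wielerDist_eq_zero h0 h1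

theorem wielerMetric_topology (h0 : 0 < γ) (h1 : γ < 1) (K : ℕ) :
    (wielerMetric g h0 h1 K).toUniformSpace.toTopologicalSpace =
      (inferInstance : TopologicalSpace (Solenoid g)) :=
  MetricSpace.topology_eq_of_tendsto _ (tendsto_wielerDist h0 h1 K)

/-- If the first `K + 1` coordinates agree, the shift contracts Wieler's metric. -/
theorem wielerDist_shift_le (h0 : 0 < γ) (h1 : γ < 1) {x y : Solenoid g}
    (h : ∀ k ≤ K, x.1 k = y.1 k) :
    wielerDist γ K (shift g x) (shift g y) ≤ γ * wielerDist γ K x y := by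
  rw [wielerDist_eq, wielerDist_eq, Finset.mul_sum]
  refine Finset.sum_le_sum fun k hk => ?_
  rw [mul_left_comm]
  refine mul_le_mul_of_nonneg_left (weightedSup_le fun i => ?_) (by positivity)
  change γ ^ i * dist (g (x.1 (i + k))) (g (y.1 (i + k))) ≤ _
  -- The shift introduces one new term, which vanishes by hypothesis; every other term is `γ` times
  -- an old one.
  rcases i with _ | i
  · rw [zero_add, h k (by simpa [Nat.lt_succ_iff] using hk), dist_self, mul_zero]
    exact mul_nonneg h0.le (weightedSup_nonneg h0 k x y)
  · rw [show i + 1 + k = i + k + 1 by ring, ← x.2, ← y.2, pow_succ', mul_assoc]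
    exact mul_le_mul_of_nonneg_left (le_weightedSup h0 h1 k x y i) h0.le

/-- If the coordinates contract by `γ ^ K` over `K` steps, the inverse shift contracts Wieler's
metric. -/
theorem wielerDist_shift_symm_le (h0 : 0 < γ) (h1 : γ < 1) (hK : 0 < K) {x y : Solenoid g}
    (h : ∀ i, dist (x.1 (i + K)) (y.1 (i + K)) ≤ γ ^ K * dist (x.1 i) (y.1 i)) :
    wielerDist γ K ((shift g).symm x) ((shift g).symm y) ≤
      2 * γ / (1 + γ ^ 2) * wielerDist γ K x y := by
  set a : ℕ → ℝ := fun k => weightedSup γ k x y with ha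
  have hlast : a (K + 1) ≤ γ ^ K * a 1 := by
    refine weightedSup_le fun i => ?_
    have h2 := le_weightedSup h0 h1 1 x y i
    have h3 := h (i + 1)
    rw [show i + (K + 1) = i + 1 + K by ring]
    calc γ ^ i * dist (x.1 (i + 1 + K)) (y.1 (i + 1 + K))
        ≤ γ ^ i * (γ ^ K * dist (x.1 (i + 1)) (y.1 (i + 1))) := by gcongr
      _ = γ ^ K * (γ ^ i * dist (x.1 (i + 1)) (y.1 (i + 1))) := by ring
      _ ≤ γ ^ K * a 1 := by gcongr
  have h01 : γ * a 1 ≤ a 0 := weightedSup_succ_le h0 h1 0 x y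
  have hnn : ∀ k, 0 ≤ a k := fun k => weightedSup_nonneg h0 k x y
  have hS : wielerDist γ K x y = ∑ k ∈ Finset.range (K + 1), (γ ^ k)⁻¹ * a k := rfl
  have hS' : wielerDist γ K ((shift g).symm x) ((shift g).symm y) =
      ∑ k ∈ Finset.range (K + 1), (γ ^ k)⁻¹ * a (k + 1) := rfl
  -- With `D` and `D'` the distances before and after, both sides equal `γ * ∑_{k ≤ K+1} γ^{-k}
  -- a_k`. Hence `D' ≤ γ D + a₁ - γ a₀ ≤ γ D + (1 - γ²) a₁`.
  have hrel : wielerDist γ K ((shift g).symm x) ((shift g).symm y) + γ * a 0 =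
      γ * wielerDist γ K x y + (γ ^ K)⁻¹ * a (K + 1) := by
    have hexp : γ * wielerDist γ K x y + (γ ^ K)⁻¹ * a (K + 1) =
        γ * ∑ k ∈ Finset.range (K + 2), (γ ^ k)⁻¹ * a k := by
      rw [hS, Finset.sum_range_succ _ (K + 1), mul_add]
      congr 1
      rw [pow_succ]
      field_simp
    rw [hexp, Finset.sum_range_succ', hS', mul_add, Finset.mul_sum]
    congr 1
    · refine Finset.sum_congr rfl fun k _ => ?_
      rw [pow_succ]
      field_simp
    · simp
  have hlast' : (γ ^ K)⁻¹ * a (K + 1) ≤ a 1 := by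
    rw [inv_mul_le_iff₀ (by positivity)]
    exact hlast
  -- Since `K ≥ 1`, the terms `k = 0, 1` both occur. With `γ a₁ ≤ a₀` they give `(1 + γ²) a₁ ≤ γ D`,
  -- and the factor becomes `γ (1 + (1 - γ²) / (1 + γ²)) = 2γ / (1 + γ²)`.
  have hlow : a 0 + γ⁻¹ * a 1 ≤ wielerDist γ K x y := by
    have hsub : Finset.range 2 ⊆ Finset.range (K + 1) := Finset.range_mono (by omega)
    have := Finset.sum_le_sum_of_subset_of_nonneg hsub
      (f := fun k => (γ ^ k)⁻¹ * a k) (fun k _ _ => mul_nonneg (by positivity) (hnn k))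
    rw [hS]
    simpa [Finset.sum_range_succ] using this
  have hlow' : (1 + γ ^ 2) * a 1 ≤ γ * wielerDist γ K x y := by
    have e : γ * (a 0 + γ⁻¹ * a 1) = γ * a 0 + a 1 := by field_simp
    nlinarith [mul_le_mul_of_nonneg_left hlow h0.le, mul_le_mul_of_nonneg_left h01 h0.le]
  rw [div_mul_eq_mul_div, le_div_iff₀ (by positivity)]
  have hgap : 0 ≤ 1 - γ ^ 2 := by nlinarith
  have hup : wielerDist γ K ((shift g).symm x) ((shift g).symm y) ≤
      γ * wielerDist γ K x y + (1 - γ ^ 2) * a 1 := by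
    nlinarith [mul_le_mul_of_nonneg_left h01 h0.le]
  nlinarith [mul_le_mul_of_nonneg_left hlow' hgap,
    mul_le_mul_of_nonneg_right hup (by positivity : (0 : ℝ) ≤ 1 + γ ^ 2)]

end WeightedSup

end Solenoid

/-! ### The Smale space structure with Wieler's metric -/

open Solenoid in
theorem IsAdaptedGauge.exists_smaleStructure {V : Type*} [MetricSpace V] [CompactSpace V]
    {g : C(V, V)} {γ δ s : ℝ} {K : ℕ} {ρ : V → V → ℝ} (h : IsAdaptedGauge g γ δ s K ρ)
    (hK : 0 < K) : ∃ S : SmaleStructure (shift g), ∀ x y, S.d x y = wielerDist γ K x y := by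
  have h0 := h.gamma_pos
  have h1 := h.gamma_lt_one
  have hs := h.s_pos
  obtain ⟨η, hη, hηρ⟩ := exists_pos_forall_lt_imp_lt (d₁ := fun v w : V => dist v w) (d₂ := ρ)
    continuous_dist h.cont (fun x y h => dist_pos.2 h) h.self hs
  have hclose : ∀ x y : Solenoid g, wielerDist γ K x y ≤ η / 2 → ∀ k ≤ K,
      ρ (x.1 k) (y.1 k) ≤ s := fun x y hxy k hk =>
    (hηρ _ _ (((dist_le_wielerDist h0 h1 hk x y).trans hxy).trans_lt (half_lt_self hη))).le
  have hclose0 : ∀ x y : Solenoid g, wielerDist γ K x y ≤ η / 2 → ρ (x.1 0) (y.1 0) ≤ s :=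
    fun x y hxy => hclose x y hxy 0 K.zero_le
  refine ⟨{
    metric := wielerMetric g h0 h1 K
    metric_topology := wielerMetric_topology h0 h1 K
    lam := 2 * γ / (1 + γ ^ 2)
    epsX := η / 2
    bracket := fun x y => liftAlong ρ s (x.1 0) y
    lam_pos := by positivity
    lam_lt_one := by
      rw [div_lt_one (by positivity)]
      nlinarith [sq_pos_of_pos (sub_pos.2 h1)]
    epsX_pos := half_pos hη
    continuousOn_bracket := ?_
    B1 := ?_
    B2 := ?_
    B3 := ?_
    B4 := ?_
    C1 := ?_
    C2 := ?_ }, fun x y => rfl⟩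
  · refine h.continuousOn_liftAlong.comp (f := fun p : Solenoid g × Solenoid g => (p.1.1 0, p.2))
      (((continuous_coord 0).comp continuous_fst).prodMk continuous_snd).continuousOn ?_
    exact fun p hp => hclose0 p.1 p.2 hp
  · exact fun x => (h.eq_liftAlong fun i => by rw [h.self]; exact hs.le).symm
  -- Both sides lift `x₀`, along `[y, z]` and along `z`, which are `s`-close in every coordinate.
  · intro x y z hyz hxw hxz
    refine h.liftAlong_eq_liftAlong (hclose0 _ _ hxw) (hclose0 _ _ hxz) fun i => ?_
    exact ((h.liftAlong_spec (hclose0 y z hyz)).2 i).trans (by linarith)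
  · intro x y z hxy _ _
    simp only [(h.liftAlong_spec (hclose0 x y hxy)).1]
  · intro x y hxy hφ
    obtain ⟨e0, e1⟩ := h.liftAlong_spec (hclose0 x y hxy)
    refine (h.eq_liftAlong (z := shift g (liftAlong ρ s (x.1 0) y)) (y := shift g y)
      fun i => ?_).trans ?_
    · rcases i with _ | i
      · change ρ (g ((liftAlong ρ s (x.1 0) y).1 0)) _ ≤ s
        rw [e0]
        exact hclose0 _ _ hφ
      · change ρ (g ((liftAlong ρ s (x.1 0) y).1 (i + 1))) (g (y.1 (i + 1))) ≤ s
        rw [← y.2, ← (liftAlong ρ s (x.1 0) y).2]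
        exact e1 i
    · change liftAlong ρ s (g ((liftAlong ρ s (x.1 0) y).1 0)) _ = _
      rw [e0]
      rfl
  · intro x y hxy hy
    have e0 : x.1 0 = y.1 0 := by
      rw [← (h.liftAlong_spec (hclose0 x y hxy)).1, hy]
    -- Coordinates up to `K` are `ρ`-close because the metric controls them, so expansion propagates
    -- equality from coordinate `0`.
    have hk : ∀ k ≤ K, x.1 k = y.1 k := by
      intro k hk
      induction k with
      | zero => exact e0
      | succ k ih =>
        refine h.eq_of_nonpos ((h.expand _ _ ((hclose x y hxy _ hk).trans
          (by linarith [h.s_le]))).trans ?_)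
        rw [← x.2, ← y.2, ih (by omega), h.self, mul_zero]
    refine (wielerDist_shift_le h0 h1 hk).trans ?_
    refine mul_le_mul_of_nonneg_right ?_ (dist_nonneg.trans (dist_le_wielerDist h0 h1 K.zero_le x y))
    rw [le_div_iff₀ (by positivity)]
    nlinarith
  · intro x y hxy hx
    refine wielerDist_shift_symm_le h0 h1 hK fun i => ?_
    have hn := (h.liftAlong_spec (hclose0 x y hxy)).2 (i + K)
    rw [hx] at hn
    have := h.expand_dist _ _ (hn.trans (by linarith [h.s_le]))
    rwa [iterate_coord, iterate_coord] at this

/-! ### Unstable sets of an arbitrary Smale structure -/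

namespace SmaleStructure

variable {X : Type*} [TopologicalSpace X] [CompactSpace X] {φ : X ≃ₜ X}

theorem continuous_d (S : SmaleStructure φ) : Continuous fun p : X × X => S.d p.1 p.2 :=
  MetricSpace.continuous_dist_of_topology_eq S.metric S.metric_topology

theorem d_self (S : SmaleStructure φ) (x : X) : S.d x x = 0 :=
  @dist_self X S.metric.toPseudoMetricSpace x

theorem d_triangle (S : SmaleStructure φ) (x y z : X) : S.d x z ≤ S.d x y + S.d y z :=
  @dist_triangle X S.metric.toPseudoMetricSpace x y z

theorem d_nonneg (S : SmaleStructure φ) (x y : X) : 0 ≤ S.d x y :=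
  @dist_nonneg X S.metric.toPseudoMetricSpace x y

theorem d_pos (S : SmaleStructure φ) {x y : X} (h : x ≠ y) : 0 < S.d x y :=
  (@dist_pos X S.metric x y).2 h

/-- C2 keeps the backward pair within `ε_X`, so B4 applies there and injectivity of `φ` carries the
bracket identity one step back. -/
theorem d_iterate_symm_le (S : SmaleStructure φ) {x y : X} (hd : S.d x y ≤ S.epsX)
    (hb : S.bracket x y = x) (n : ℕ) :
    S.bracket (φ.symm^[n] x) (φ.symm^[n] y) = φ.symm^[n] x ∧
      S.d (φ.symm^[n] x) (φ.symm^[n] y) ≤ S.d x y := by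
  induction n with
  | zero => exact ⟨hb, le_rfl⟩
  | succ n ih =>
    simp only [Function.iterate_succ_apply']
    set a := φ.symm^[n] x
    set b := φ.symm^[n] y
    have hab : S.d a b ≤ S.epsX := ih.2.trans hd
    have hle : S.d (φ.symm a) (φ.symm b) ≤ S.d a b :=
      (S.C2 a b hab ih.1).trans (mul_le_of_le_one_left (S.d_nonneg a b) S.lam_lt_one.le)
    refine ⟨φ.injective ?_, hle.trans ih.2⟩
    rw [S.B4 _ _ (hle.trans hab) (by simp only [φ.apply_symm_apply]; exact hab)]
    simpa using ih.1

/-- Points whose backward orbits stay close are locally unstably equivalent. -/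
theorem exists_bracket_eq_of_backward_close (S : SmaleStructure φ) :
    ∃ ε > 0, ε ≤ S.epsX ∧
      ∀ x y, (∀ n : ℕ, S.d (φ.symm^[n] x) (φ.symm^[n] y) < ε) → S.bracket x y = x := by
  have hclosed : IsClosed {p : X × X | S.d p.1 p.2 ≤ S.epsX} :=
    isClosed_le S.continuous_d continuous_const
  have hcont : ContinuousOn (fun p : X × X => S.d p.1 (S.bracket p.1 p.2))
      {p | S.d p.1 p.2 ≤ S.epsX} :=
    S.continuous_d.comp_continuousOn (continuousOn_fst.prodMk S.continuousOn_bracket)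
  -- Pairs whose bracket is at least `ε_X` away from `x` form a closed set off the diagonal, so
  -- points less than `η` apart avoid it.
  obtain ⟨η, hη, hηle⟩ := exists_pos_forall_mem_le S.continuous_d
    (hcont.preimage_isClosed_of_isClosed hclosed (isClosed_Ici (a := S.epsX))) (by
      rintro ⟨x, y⟩ ⟨_, hxy⟩
      refine S.d_pos fun e => ?_
      obtain rfl : x = y := e
      have : S.epsX ≤ S.d x (S.bracket x x) := hxy
      rw [S.B1, S.d_self] at this
      exact absurd S.epsX_pos (not_lt.2 this))
  refine ⟨min η S.epsX, lt_min hη S.epsX_pos, min_le_right _ _, fun x y h => ?_⟩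
  have hle : ∀ n : ℕ, S.d (φ.symm^[n] x) (φ.symm^[n] y) ≤ S.epsX := fun n =>
    (h n).le.trans (min_le_right _ _)
  have hbr : ∀ n : ℕ, S.d (φ.symm^[n] x) (S.bracket (φ.symm^[n] x) (φ.symm^[n] y)) ≤ S.epsX := by
    intro n
    by_contra! hc
    exact absurd (hηle (φ.symm^[n] x, φ.symm^[n] y) ⟨hle n, hc.le⟩)
      (not_le.2 ((h n).trans_le (min_le_left _ _)))
  have hφ : ∀ (n : ℕ) (z : X), φ (φ.symm^[n + 1] z) = φ.symm^[n] z := fun n z => by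
    rw [Function.iterate_succ_apply', φ.apply_symm_apply]
  -- The pair `x, [x, y]` is stable: its distance is `λ^n` times a bounded distance `n` steps back,
  -- hence zero.
  have hstep : ∀ n : ℕ, S.d x (S.bracket x y) ≤
      S.lam ^ n * S.d (φ.symm^[n] x) (S.bracket (φ.symm^[n] x) (φ.symm^[n] y)) := by
    intro n
    induction n with
    | zero => simp
    | succ n ih =>
      refine ih.trans ?_
      rw [pow_succ, mul_assoc]
      refine mul_le_mul_of_nonneg_left ?_ (pow_nonneg S.lam_pos.le n)
      have h1 := S.C1 (φ.symm^[n + 1] x) (S.bracket (φ.symm^[n + 1] x) (φ.symm^[n + 1] y))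
        (hbr (n + 1)) (S.B2 _ _ _ (hle (n + 1)) (hbr (n + 1)) (hle (n + 1)))
      rw [S.B4 _ _ (hle (n + 1)) (by rw [hφ, hφ]; exact hle n), hφ, hφ] at h1
      exact h1
  have hlim : Tendsto (fun n : ℕ => S.lam ^ n * S.epsX) atTop (𝓝 0) := by
    simpa using (tendsto_pow_atTop_nhds_zero_of_lt_one S.lam_pos.le S.lam_lt_one).mul_const S.epsX
  have hzero : S.d x (S.bracket x y) ≤ 0 := ge_of_tendsto' hlim fun n =>
    (hstep n).trans (mul_le_mul_of_nonneg_left (hbr n) (pow_nonneg S.lam_pos.le n))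
  by_contra hne
  exact absurd (S.d_pos (Ne.symm hne)) (not_lt.2 hzero)

/-- The topology of the unstable set is that of uniform convergence of backward orbits. -/
theorem unstableSet_mem_nhds_iff (S : SmaleStructure φ) {P : Set X} {y : S.UnstableSet P}
    {U : Set (S.UnstableSet P)} :
    U ∈ 𝓝 y ↔ ∃ ε > 0, ∀ z : S.UnstableSet P,
      (∀ n : ℕ, S.d (φ.symm^[n] y.1) (φ.symm^[n] z.1) < ε) → z ∈ U := by
  obtain ⟨ε₀, hε₀, hε₀le, hbr⟩ := S.exists_bracket_eq_of_backward_close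
  constructor
  · intro hU
    obtain ⟨W, hWU, hW, hyW⟩ := mem_nhds_iff.1 hU
    -- The claim is made at every point of `W`, so that it passes through the generation of open
    -- sets.
    suffices ∀ y ∈ W, ∃ ε > 0, ∀ z : S.UnstableSet P,
        (∀ n : ℕ, S.d (φ.symm^[n] y.1) (φ.symm^[n] z.1) < ε) → z ∈ W by
      obtain ⟨ε, hε, h⟩ := this y hyW
      exact ⟨ε, hε, fun z hz => hWU (h z hz)⟩
    clear hyW hWU hU
    induction hW with
    | basic W hW =>
      obtain ⟨x, ε, hε, hεle, rfl⟩ := hW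
      rintro y ⟨hd, hb⟩
      -- The bound `ε₀` forces `[y, z] = y`, whence `[x, z] = [x, [y, z]] = [x, y] = x`; the other
      -- bound is the triangle inequality.
      refine ⟨min ε₀ (ε - S.d x.1 y.1), lt_min hε₀ (sub_pos.2 hd), fun z hz => ?_⟩
      have hyz : S.d y.1 z.1 < min ε₀ (ε - S.d x.1 y.1) := hz 0
      have hyz' : S.d y.1 z.1 ≤ S.epsX := (hyz.trans_le (min_le_left _ _)).le.trans hε₀le
      have hxz : S.d x.1 z.1 < ε := by
        linarith [S.d_triangle x.1 y.1 z.1, min_le_right ε₀ (ε - S.d x.1 y.1)]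
      have hbyz : S.bracket y.1 z.1 = y.1 :=
        hbr _ _ fun n => (hz n).trans_le (min_le_left _ _)
      refine ⟨hxz, ?_⟩
      have := S.B2 x.1 y.1 z.1 hyz' (by rw [hbyz]; exact hd.le.trans hεle) (hxz.le.trans hεle)
      rw [← this, hbyz, hb]
    | univ => exact fun _ _ => ⟨1, one_pos, fun _ _ => trivial⟩
    | inter W₁ W₂ _ _ ih₁ ih₂ =>
      rintro y ⟨h₁, h₂⟩
      obtain ⟨ε₁, hε₁, h₁⟩ := ih₁ y h₁
      obtain ⟨ε₂, hε₂, h₂⟩ := ih₂ y h₂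
      exact ⟨min ε₁ ε₂, lt_min hε₁ hε₂, fun z hz =>
        ⟨h₁ z fun n => (hz n).trans_le (min_le_left _ _),
          h₂ z fun n => (hz n).trans_le (min_le_right _ _)⟩⟩
    | sUnion W _ ih =>
      rintro y ⟨W', hW', hy⟩
      obtain ⟨ε, hε, h⟩ := ih W' hW' y hy
      exact ⟨ε, hε, fun z hz => ⟨W', hW', h z hz⟩⟩
  · rintro ⟨ε, hε, h⟩
    have hopen : IsOpen {z : S.UnstableSet P | z.1 ∈ S.localUnstable y.1 (min ε S.epsX)} :=
      TopologicalSpace.isOpen_generateFrom_of_mem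
        ⟨y, min ε S.epsX, lt_min hε S.epsX_pos, min_le_right _ _, rfl⟩
    refine mem_of_superset (hopen.mem_nhds ⟨?_, S.B1 _⟩) ?_
    · rw [S.d_self]
      exact lt_min hε S.epsX_pos
    · rintro z ⟨hd, hb⟩
      exact h z fun n => (S.d_iterate_symm_le (hd.le.trans (min_le_right _ _)) hb n).2.trans_lt
        (hd.trans_le (min_le_left _ _))

theorem UnstableEquiv.map {S : SmaleStructure φ} {x y : X} (h : S.UnstableEquiv x y) :
    S.UnstableEquiv (φ x) (φ y) := by
  refine (tendsto_add_atTop_iff_nat 1).1 ?_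
  simp only [Function.iterate_succ_apply, φ.symm_apply_apply]
  exact h

end SmaleStructure

/-! ### Unstable sets in terms of the gauge -/

namespace IsAdaptedGauge

open Solenoid

variable {V : Type*} [MetricSpace V] [CompactSpace V] {g : C(V, V)} {γ δ s : ℝ} {K : ℕ}
  {ρ : V → V → ℝ}

theorem exists_gauge_lt (h : IsAdaptedGauge g γ δ s K ρ) (S : SmaleStructure (shift g)) {r : ℝ}
    (hr : 0 < r) : ∃ ε > 0, ∀ x y : Solenoid g, S.d x y < ε → ρ (x.1 0) (y.1 0) < r :=
  exists_pos_forall_lt_imp_lt (d₁ := S.d) (d₂ := fun x y : Solenoid g => ρ (x.1 0) (y.1 0))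
    S.continuous_d (h.cont.comp (((continuous_coord 0).comp continuous_fst).prodMk
      ((continuous_coord 0).comp continuous_snd))) (fun _ _ => S.d_pos) (fun _ => h.self _) hr

/-- Continuous metrics on a compact space are uniformly comparable. The auxiliary metric `wielerDist
γ 0` is a single weighted supremum, directly bounded by the coordinates. -/
theorem exists_d_lt (h : IsAdaptedGauge g γ δ s K ρ) (S : SmaleStructure (shift g)) {ε : ℝ}
    (hε : 0 < ε) :
    ∃ r > 0, ∀ x y : Solenoid g, (∀ i, ρ (x.1 i) (y.1 i) < r) → S.d x y < ε := by
  have h0 := h.gamma_pos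
  have h1 := h.gamma_lt_one
  obtain ⟨η, hη, hlt⟩ := exists_pos_forall_lt_imp_lt (d₁ := wielerDist (g := g) γ 0) (d₂ := S.d)
    (MetricSpace.continuous_dist_of_topology_eq _ (wielerMetric_topology h0 h1 0))
    S.continuous_d (fun x y => (@dist_pos _ (wielerMetric g h0 h1 0) x y).2) S.d_self hε
  refine ⟨η / 2, half_pos hη, fun x y hxy => hlt x y (lt_of_le_of_lt ?_ (half_lt_self hη))⟩
  rw [wielerDist_eq]
  simp only [zero_add, Finset.range_one, Finset.sum_singleton, pow_zero, inv_one, one_mul]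
  refine weightedSup_le fun i => ?_
  exact (mul_le_of_le_one_left dist_nonneg (pow_le_one₀ h0.le h1.le)).trans
    ((h.dist_le _ _).trans (hxy i).le)

/-- The zeroth coordinate of `φ^{-n} x` is `x_n`, so closeness of backward orbits means closeness of
coordinates. The criterion no longer involves the metric or bracket of `S`. -/
theorem unstableSet_mem_nhds_iff (h : IsAdaptedGauge g γ δ s K ρ) {S : SmaleStructure (shift g)}
    {P : Set (Solenoid g)} {y : S.UnstableSet P} {U : Set (S.UnstableSet P)} :
    U ∈ 𝓝 y ↔ ∃ r > 0, ∀ z : S.UnstableSet P, (∀ i, ρ (y.1.1 i) (z.1.1 i) < r) → z ∈ U := by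
  rw [S.unstableSet_mem_nhds_iff]
  constructor
  · rintro ⟨ε, hε, hU⟩
    obtain ⟨r, hr, hd⟩ := h.exists_d_lt S hε
    refine ⟨r, hr, fun z hz => hU z fun n => hd _ _ fun i => ?_⟩
    rw [shift_symm_iterate_coord, shift_symm_iterate_coord]
    exact hz _
  · rintro ⟨r, hr, hU⟩
    obtain ⟨ε, hε, hd⟩ := h.exists_gauge_lt S hr
    refine ⟨ε, hε, fun z hz => hU z fun i => ?_⟩
    have := hd _ _ (hz i)
    rwa [shift_symm_iterate_coord, shift_symm_iterate_coord, zero_add] at this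

/-- A point following the backward orbit of `y` is unstably equivalent to everything that `y` is. -/
theorem unstableEquiv_of_near (h : IsAdaptedGauge g γ δ s K ρ) {S : SmaleStructure (shift g)}
    {z y p : Solenoid g} (hz : ∀ i, ρ (z.1 i) (y.1 i) ≤ s) (hy : S.UnstableEquiv y p) :
    S.UnstableEquiv z p := by
  have hle : ∀ i, ρ (z.1 i) (y.1 i) ≤ γ ^ i * ρ (z.1 0) (y.1 0) :=
    h.coord_le fun i => (hz i).trans (by linarith [h.s_le, h.s_pos])
  have hlim : Tendsto (fun n : ℕ => γ ^ n * ρ (z.1 0) (y.1 0)) atTop (𝓝 0) := by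
    simpa using (tendsto_pow_atTop_nhds_zero_of_lt_one h.gamma_pos.le h.gamma_lt_one).mul_const
      (ρ (z.1 0) (y.1 0))
  have hzy : S.UnstableEquiv z y := by
    refine tendsto_order.2 ⟨fun a ha => Eventually.of_forall fun n =>
      ha.trans_le (S.d_nonneg _ _), fun a ha => ?_⟩
    obtain ⟨r, hr, hd⟩ := h.exists_d_lt S ha
    filter_upwards [hlim.eventually_lt_const hr] with n hn
    refine hd _ _ fun i => ?_
    rw [shift_symm_iterate_coord, shift_symm_iterate_coord]
    refine (hle _).trans_lt (lt_of_le_of_lt ?_ hn)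
    exact mul_le_mul_of_nonneg_right (pow_le_pow_of_le_one h.gamma_pos.le h.gamma_lt_one.le
      (Nat.le_add_left n i)) (h.nonneg _ _)
  have hsum := Tendsto.add hzy hy
  rw [add_zero] at hsum
  exact squeeze_zero (fun n => S.d_nonneg _ _) (fun n => S.d_triangle _ _ _) hsum

end IsAdaptedGauge

/-- A family of continuous local sections and a locally constant index function give an even
covering. -/
theorem isEvenlyCovered_of_lift {E B I : Type*} [TopologicalSpace E] [TopologicalSpace B]
    [TopologicalSpace I] [DiscreteTopology I] {f : E → B} (hf : Continuous f) {b : B} {U : Set B}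
    (hb : b ∈ U) (hU : IsOpen U) (lift : B → I → E) (idx : f ⁻¹' U → I)
    (hfl : ∀ w ∈ U, ∀ i, f (lift w i) = w)
    (hil : ∀ (e : f ⁻¹' U) (w : B) (i : I), w ∈ U → e.1 = lift w i → idx e = i)
    (hli : ∀ e : f ⁻¹' U, lift (f e) (idx e) = e)
    (hlift : ∀ i, ContinuousOn (fun w => lift w i) U) (hidx : Continuous idx) :
    IsEvenlyCovered f b I := by
  refine ⟨inferInstance, U, hb, hU, hU.preimage hf, {
    toFun := fun e => (⟨f e, e.2⟩, idx e)
    invFun := fun p => ⟨lift p.1 p.2, by rw [mem_preimage, hfl _ p.1.2]; exact p.1.2⟩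
    left_inv := fun e => Subtype.ext (hli e)
    right_inv := fun p => Prod.ext (Subtype.ext (hfl _ p.1.2 _)) (hil _ _ _ p.1.2 rfl)
    continuous_toFun := ((hf.comp continuous_subtype_val).subtype_mk _).prodMk hidx
    continuous_invFun := ?_ }, fun _ => rfl⟩
  refine Continuous.subtype_mk ?_ _
  refine continuous_prod_of_discrete_right.2 fun i => ?_
  exact (hlift i).domRestrict

/-! ### The projection is a covering map and is surjective -/

namespace IsAdaptedGauge

open Solenoid

variable {V : Type*} [MetricSpace V] [CompactSpace V] {g : C(V, V)} {γ δ s : ℝ} {K : ℕ}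
  {ρ : V → V → ℝ} {S : SmaleStructure (shift g)} {P : Set (Solenoid g)}

/-- The lift of a point of `V` along a point of the unstable set. -/
noncomputable def unstableLift (h : IsAdaptedGauge g γ δ s K ρ) (w : V) (y : S.UnstableSet P) :
    S.UnstableSet P :=
  ⟨liftAlong ρ s w y.1, y.2.imp fun _ hp =>
    ⟨hp.1, h.unstableEquiv_of_near (h.liftAlong_near w y.1) hp.2⟩⟩

theorem continuous_unstableSet_proj (h : IsAdaptedGauge g γ δ s K ρ) :
    Continuous fun x : S.UnstableSet P => proj 0 x.1 := by
  refine continuous_iff_continuousAt.2 fun x => Metric.tendsto_nhds.2 fun r hr => ?_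
  refine h.unstableSet_mem_nhds_iff.2 ⟨r, hr, fun z hz => ?_⟩
  rw [mem_ofPred_eq, dist_comm]
  exact (h.dist_le _ _).trans_lt (hz 0)

/-- Over the `ρ`-ball of radius `s` about `v`, sheets are indexed by the fibre over `v`. Lifting `w`
along a fibre point and lifting `v` along `e` are mutually inverse, because following an orbit
within `s` is a symmetric relation. -/
theorem isCoveringMap_unstableSet_proj (h : IsAdaptedGauge g γ δ s K ρ) :
    IsCoveringMap fun x : S.UnstableSet P => proj 0 x.1 := by
  intro v
  -- The index set is the fibre made discrete by fiat; `to_isEvenlyCovered_preimage` passes to the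
  -- fibre with its own topology.
  let _ : TopologicalSpace {x : S.UnstableSet P // x.1.1 0 = v} := ⊥
  have : DiscreteTopology {x : S.UnstableSet P // x.1.1 0 = v} := ⟨rfl⟩
  have hback : ∀ e : (fun x : S.UnstableSet P => proj 0 x.1) ⁻¹' {w | ρ w v < s},
      ρ v (e.1.1.1 0) ≤ s := fun e => by
    rw [h.comm]
    exact le_of_lt e.2
  have hfib : ∀ (w : V) (x : {x : S.UnstableSet P // x.1.1 0 = v}), ρ w v < s →
      ρ w (x.1.1.1 0) ≤ s := fun w x hw => by
    rw [x.2]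
    exact hw.le
  refine IsEvenlyCovered.to_isEvenlyCovered_preimage (isEvenlyCovered_of_lift
    (I := {x : S.UnstableSet P // x.1.1 0 = v}) (U := {w | ρ w v < s})
    h.continuous_unstableSet_proj ?_ (h.isOpen_gauge_ball v s)
    (fun w x => h.unstableLift w x.1)
    (fun e => ⟨h.unstableLift v e.1, (h.liftAlong_spec (hback e)).1⟩) ?_ ?_ ?_ ?_ ?_)
  · change ρ v v < s
    rw [h.self]
    exact h.s_pos
  · exact fun w hw x => (h.liftAlong_spec (hfib w x hw)).1
  · rintro e w x hw he
    refine Subtype.ext (Subtype.ext ?_)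
    have hnear : ∀ i, ρ (x.1.1.1 i) (e.1.1.1 i) ≤ s := fun i => by
      rw [he, h.comm]
      exact h.liftAlong_near w x.1.1 i
    have := h.eq_liftAlong hnear
    rw [x.2] at this
    exact this.symm
  · intro e
    refine Subtype.ext (h.eq_liftAlong (z := e.1.1) fun i => ?_).symm
    rw [h.comm]
    exact h.liftAlong_near v e.1.1 i
  · intro x w₀ hw₀
    refine ContinuousAt.continuousWithinAt fun N hN => ?_
    obtain ⟨r, hr, hsub⟩ := h.unstableSet_mem_nhds_iff.1 hN
    have hmem : {w | ρ w v < s} ∩ {w | ρ w w₀ < r} ∈ 𝓝 w₀ :=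
      inter_mem ((h.isOpen_gauge_ball v s).mem_nhds hw₀) ((h.isOpen_gauge_ball w₀ r).mem_nhds
        (by rw [mem_ofPred_eq, h.self]; exact hr))
    refine mem_map.2 ?_
    filter_upwards [hmem] with w hw
    refine hsub _ fun i => ?_
    -- Two lifts along one orbit are `2 * s ≤ δ` apart, so their zeroth coordinates bound all the
    -- others.
    have hnear : ∀ i, ρ ((liftAlong ρ s w₀ x.1.1).1 i) ((liftAlong ρ s w x.1.1).1 i) ≤ δ := by
      intro i
      have h1 := h.liftAlong_near w x.1.1 i
      rw [h.comm] at h1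
      linarith [h.liftAlong_near w₀ x.1.1 i, h.triangle ((liftAlong ρ s w₀ x.1.1).1 i)
        (x.1.1.1 i) ((liftAlong ρ s w x.1.1).1 i), h.s_le, h.s_pos]
    refine (h.coord_le_zero hnear i).trans_lt ?_
    rw [(h.liftAlong_spec (hfib w₀ x hw₀)).1, (h.liftAlong_spec (hfib w x hw.1)).1, h.comm]
    exact hw.2
  · refine continuous_iff_continuousAt.2 fun e => ?_
    refine continuousAt_const.congr (f := fun _ => (⟨h.unstableLift v e.1,
      (h.liftAlong_spec (hback e)).1⟩ : {x : S.UnstableSet P // x.1.1 0 = v})) ?_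
    -- Lifting `v` along two orbits within `s` of each other gives the same point, so the sheet
    -- index is locally constant.
    have hN : {z : S.UnstableSet P | ∀ i, ρ (e.1.1.1 i) (z.1.1 i) < s} ∈ 𝓝 e.1 :=
      h.unstableSet_mem_nhds_iff.2 ⟨s, h.s_pos, fun z hz => hz⟩
    filter_upwards [continuous_subtype_val.continuousAt.preimage_mem_nhds hN] with z hz
    refine Subtype.ext (Subtype.ext ?_)
    exact h.liftAlong_eq_liftAlong (hback e) (hback z) fun i =>
      (hz i).le.trans (by linarith [h.s_pos])

/-- A proper image would be a nonempty clopen set mapped into itself by `g`; its preimage in `X`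
could then never be moved by the shift into the nonempty open complement. -/
theorem surjective_unstableSet_proj (h : IsAdaptedGauge g γ δ s K ρ)
    (hsurj : Function.Surjective g) (hirr : IsIrreducibleSystem (shift g)) (hne : P.Nonempty)
    (hinv : ∀ p ∈ P, shift g p ∈ P) :
    Function.Surjective fun x : S.UnstableSet P => proj 0 x.1 := by
  set A : Set V := range fun x : S.UnstableSet P => proj 0 x.1 with hA
  have hnear : ∀ v ∈ A, ∀ w, ρ w v < s → w ∈ A := by
    rintro _ ⟨x, rfl⟩ w hw
    exact ⟨h.unstableLift w x, (h.liftAlong_spec hw.le).1⟩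
  have hopen : IsOpen A := isOpen_iff_mem_nhds.2 fun v hv =>
    mem_of_superset ((h.isOpen_gauge_ball v s).mem_nhds (by
      rw [mem_ofPred_eq, h.self]; exact h.s_pos)) (hnear v hv)
  have hcompl : IsOpen Aᶜ := isOpen_iff_mem_nhds.2 fun v hv =>
    mem_of_superset ((h.isOpen_gauge_ball v s).mem_nhds (by
      rw [mem_ofPred_eq, h.self]; exact h.s_pos)) fun w hw hwA =>
        hv (hnear w hwA v (by rw [h.comm]; exact hw))
  have hgA : ∀ (n : ℕ), ∀ v ∈ A, g^[n] v ∈ A := by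
    intro n
    induction n with
    | zero => exact fun v hv => hv
    | succ n ih =>
      rintro v ⟨⟨x, p, hp, hxp⟩, rfl⟩
      exact ih _ ⟨⟨shift g x, shift g p, hinv p hp, hxp.map⟩, rfl⟩
  have hshift : ∀ (n : ℕ) (x : Solenoid g), ((shift g)^[n] x).1 0 = g^[n] (x.1 0) := by
    intro n
    induction n with
    | zero => exact fun x => rfl
    | succ n ih => exact fun x => ih (shift g x)
  by_contra hns
  obtain ⟨v, hv⟩ : ∃ v, v ∉ A := by
    by_contra! hall
    exact hns hall
  obtain ⟨p, hp⟩ := hne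
  have hpA : p.1 0 ∈ A := ⟨⟨p, p, hp, by
    simp only [SmaleStructure.UnstableEquiv, S.d_self]
    exact tendsto_const_nhds⟩, rfl⟩
  -- Surjectivity of `g` gives the missed point a backward orbit, so the complement is nonempty in
  -- `X` as well.
  have hlift : ∃ z : Solenoid g, z.1 0 = v := by
    choose f hf using hsurj
    exact ⟨⟨fun n => Nat.rec v (fun _ => f) n, fun i => (hf _).symm⟩, rfl⟩
  obtain ⟨z, hz⟩ := hlift
  obtain ⟨N, _, ⟨x, hx, rfl⟩, hxN⟩ := hirr _ _ (hopen.preimage (continuous_coord 0))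
    (hcompl.preimage (continuous_coord 0)) ⟨p, hpA⟩ ⟨z, by rw [mem_preimage, hz]; exact hv⟩
  rw [mem_preimage, hshift] at hxN
  exact hxN (hgA N _ hx)

end IsAdaptedGauge

theorem theorem2p9 {V : Type*} [MetricSpace V] [CompactSpace V] (g : C(V, V))
    (hsurj : Function.Surjective g) (hopen : IsOpenMap g)
    (β γ : ℝ) (K : ℕ) (hW : WielerAxioms g β γ K)
    (hirr : IsIrreducibleSystem (Solenoid.shift g))
    (P : Set (Solenoid g)) (hfin : P.Finite) (hne : P.Nonempty)
    (hinv : ∀ p ∈ P, Solenoid.shift g p ∈ P)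
    (hper : ∀ p ∈ P, p ∈ Function.periodicPts (Solenoid.shift g)) :
    (∃ S : SmaleStructure (Solenoid.shift g), ∀ x y, S.d x y = Solenoid.wielerDist γ K x y) ∧
    ∀ S : SmaleStructure (Solenoid.shift g),
      Function.Surjective (fun x : S.UnstableSet P => Solenoid.proj 0 x.1) ∧
      IsCoveringMap (fun x : S.UnstableSet P => Solenoid.proj 0 x.1) := by
  obtain ⟨δ, s, ρ, h⟩ := hW.exists_gauge g.continuous hsurj hopen
  exact ⟨h.exists_smaleStructure hW.K_pos, fun S =>
    ⟨h.surjective_unstableSet_proj hsurj hirr hne hinv, h.isCoveringMap_unstableSet_proj⟩⟩
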